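/- Let $K$ be a number field with exactly $s>0$ real embeddings $\sigma_1,\dots,\sigma_s$ and $2t>0$ non-real complex embeddings $\sigma_{s+1},\dots,\sigma_{s+2t}$, numbered so that $\sigma_{s+t+j}=\overline{\sigma_{s+j}}$ for $1\le j\le t$. Let $U$ be an admissible group of totally positive units of the ring of integers $\mathcal O_K$, i.e. $U$ has rank $s$ and the image of $U$ in $\mathbb R^s$ under $u\mapsto(\log|\sigma_1(u)|,\dots,\log|\sigma_s(u)|)$ is a full lattice. Let $X=X(K,U)$ be the Oeljeklaus–Toma manifold $(\mathbb H^s\times\mathbb C^t)/(U\ltimes\mathcal O_K)$, where $\mathbb H$ is the upper half plane, $a\in\mathcal O_K$ acts by $(z_k)_k\mapsto(z_k+\sigma_k(a))_k$ and $u\in U$ acts by $(z_k)_k\mapsto(\sigma_k(u)z_k)_k$, $1\le k\le s+t$. Suppose that $X$ has an LCK metric, i.e. that there is a Kähler form $\tilde\omega$ on the universal covering $\mathbb H^s\times\mathbb C^t$ of $X$ such that every deck transformation $\gamma$ acts by a holomorphic homothety, $\gamma^*\tilde\omega=\chi(\gamma)\tilde\omega$ with $\chi(\gamma)\in\mathbb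 R_{>0}$ (the automorphy factors of the metric). Then for every $u\in U$ $$\chi(u)=|\sigma_{s+1}(u)|^2=\dots=|\sigma_{s+t}(u)|^2 .$$ In particular $|\sigma_{s+1}(u)|=\dots=|\sigma_{s+t}(u)|$ for every $u\in U$. -/

import Mathlib

open scoped ContDiff
open NumberField

noncomputable section

/-! ### Kähler forms and LCK metrics

`D` is an open subset of `ℂ^ι`, and `p : D → X` is the universal covering of a complex manifold `X`,
whose group of deck transformations is `π_1(X)`. The complex structure of `X` is the one for which `p`
is locally biholomorphic, so that forms and maps can be described on `D`. -/

namespace LCK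

variable {ι : Type*} [Fintype ι]

/-- Real differential 2-forms on `ℂ^ι`. -/
abbrev TwoForm (ι : Type*) [Fintype ι] : Type _ :=
  (ι → ℂ) → (ι → ℂ) [⋀^Fin 2]→L[ℝ] ℝ

/-- `η` is the Kähler form of a Kähler metric on the open set `D`: smooth, closed, of type `(1,1)`
(invariant under multiplication by `i`), and positive. The metric is `g(v, w) = η(v, i w)`. -/
structure IsKahler (D : TopologicalSpace.Opens (ι → ℂ)) (η : TwoForm ι) : Prop where
  smooth : ContDiffOn ℝ ∞ η D
  closed : ∀ z ∈ D, extDeriv η z = 0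
  invariant : ∀ z ∈ D, ∀ v w : ι → ℂ, η z ![Complex.I • v, Complex.I • w] = η z ![v, w]
  positive : ∀ z ∈ D, ∀ v : ι → ℂ, v ≠ 0 → 0 < η z ![v, Complex.I • v]

/-- A self-map of the open set `D`, viewed as a map of the ambient space (identity outside `D`).
Only its values and derivatives at points of `D` are used. -/
def ambient {D : TopologicalSpace.Opens (ι → ℂ)} (f : D → D) (z : ι → ℂ) : ι → ℂ :=
  open Classical in if hz : z ∈ D then (f ⟨z, hz⟩ : ι → ℂ) else z

/-- The pullback `f^* η` at a point of `D`. -/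
def pullback {D : TopologicalSpace.Opens (ι → ℂ)} (f : D → D) (η : TwoForm ι) (z : ι → ℂ) :
    (ι → ℂ) [⋀^Fin 2]→L[ℝ] ℝ :=
  (η (ambient f z)).compContinuousLinearMap (fderiv ℝ (ambient f) z)

/-- The group of deck transformations of `p : D → X`. -/
def deckGroup {D X : Type*} [TopologicalSpace D] (p : D → X) : Subgroup (D ≃ₜ D) where
  carrier := {γ | ∀ z, p (γ z) = p z}
  one_mem' := fun _ => rfl
  mul_mem' := by
    intro a b ha hb z
    exact (ha (b z)).trans (hb z)
  inv_mem' := by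
    intro a ha z
    have h := ha (a.symm z)
    rw [a.apply_symm_apply] at h
    exact h.symm

/-- An LCK metric on the base `X` of the covering `p : D → X`: a Kähler metric on `D` on which
the deck transformations act by holomorphic homotheties. The number `factor γ` is the automorphy
factor `χ(γ)`. -/
structure LCKMetric {X : Type*} (D : TopologicalSpace.Opens (ι → ℂ)) (p : D → X) where
  form : TwoForm ι
  isKahler : IsKahler D form
  factor : deckGroup p → ℝ
  factor_pos : ∀ γ, 0 < factor γ
  holomorphic : ∀ γ : deckGroup p, DifferentiableOn ℂ (ambient (γ : D ≃ₜ D)) D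
  homothety : ∀ γ : deckGroup p, ∀ z ∈ D,
    pullback (γ : D ≃ₜ D) form z = factor γ • form z

end LCK

/-! ### Oeljeklaus-Toma manifolds -/

namespace OeljeklausToma

/-- A numbering of the embeddings of `K` into `ℂ`: `s` real ones `σ_1, …, σ_s` (`emb (inl i)`)
and `2t` complex ones, `σ_{s+1}, …, σ_{s+t}` (`emb (inr (inl j))`) and their conjugates
`σ_{s+t+j}` (`emb (inr (inr j))`). -/
structure Embeddings (K : Type*) [Field K] (s t : ℕ) where
  emb : Fin s ⊕ (Fin t ⊕ Fin t) ≃ (K →+* ℂ)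
  isReal : ∀ i, ComplexEmbedding.IsReal (emb (Sum.inl i))
  conj : ∀ j, emb (Sum.inr (Sum.inr j)) = ComplexEmbedding.conjugate (emb (Sum.inr (Sum.inl j)))

/-- The embeddings `σ_1, …, σ_{s+t}`. -/
def Embeddings.coord {K : Type*} [Field K] {s t : ℕ} (σ : Embeddings K s t) :
    Fin s ⊕ Fin t → (K →+* ℂ)
  | Sum.inl i => σ.emb (Sum.inl i)
  | Sum.inr j => σ.emb (Sum.inr (Sum.inl j))

/-- The group of totally positive units of the ring of integers of `K`. -/
def totallyPositiveUnits (K : Type*) [Field K] : Subgroup (𝓞 K)ˣ where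
  carrier := {u | ∀ φ : K →+* ℝ, 0 < φ ((u : 𝓞 K) : K)}
  one_mem' := by intro φ; simp
  mul_mem' := by
    intro a b ha hb φ
    simpa using mul_pos (ha φ) (hb φ)
  inv_mem' := by
    intro a ha φ
    have h : φ ((a : 𝓞 K) : K) * φ (((a⁻¹ : (𝓞 K)ˣ) : 𝓞 K) : K) = 1 := by
      rw [← map_mul, ← map_mul, Units.mul_inv, map_one, map_one]
    exact (pos_iff_pos_of_mul_pos (h ▸ one_pos)).1 (ha φ)

/-- The space `ℍ^s × ℂ^t`, an open subset of `ℂ^{s+t}`. -/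
def space (s t : ℕ) : TopologicalSpace.Opens (Fin s ⊕ Fin t → ℂ) where
  carrier := {z | ∀ i : Fin s, 0 < (z (Sum.inl i)).im}
  is_open' := by
    simp only [Set.ofPred_forall]
    exact isOpen_iInter_of_finite fun i =>
      isOpen_lt continuous_const (Complex.continuous_im.comp (continuous_apply _))

section

variable {K : Type*} [Field K] {s t : ℕ} (σ : Embeddings K s t)

theorem coord_inl_eq_ofReal (i : Fin s) (x : K) :
    σ.coord (Sum.inl i) x = (((σ.isReal i).embedding x : ℝ) : ℂ) :=
  ((σ.isReal i).coe_embedding_apply x).symm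

/-- The translation `z ↦ (z_k + σ_k(a))_k`. -/
def translate (a : 𝓞 K) (z : space s t) : space s t :=
  ⟨fun k => z.1 k + σ.coord k (a : K), fun i => by
    have h : 0 < (z.1 (Sum.inl i)).im := z.2 i
    change 0 < (z.1 (Sum.inl i) + σ.coord (Sum.inl i) (a : K)).im
    rw [coord_inl_eq_ofReal, Complex.add_im, Complex.ofReal_im, add_zero]
    exact h⟩

/-- The map `z ↦ (σ_k(u) z_k)_k`. -/
def scale (u : totallyPositiveUnits K) (z : space s t) : space s t :=
  ⟨fun k => σ.coord k (((u : (𝓞 K)ˣ) : 𝓞 K) : K) * z.1 k, fun i => by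
    have h : 0 < (z.1 (Sum.inl i)).im := z.2 i
    have hu := u.2 (σ.isReal i).embedding
    change 0 < (σ.coord (Sum.inl i) (((u : (𝓞 K)ˣ) : 𝓞 K) : K) * z.1 (Sum.inl i)).im
    rw [coord_inl_eq_ofReal, Complex.im_ofReal_mul]
    exact mul_pos hu h⟩

theorem continuous_translate (a : 𝓞 K) : Continuous (translate σ a) := by
  refine Continuous.subtype_mk (continuous_pi fun k => ?_) _
  exact ((continuous_apply k).comp continuous_subtype_val).add continuous_const

theorem continuous_scale (u : totallyPositiveUnits K) : Continuous (scale σ u) := by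
  refine Continuous.subtype_mk (continuous_pi fun k => ?_) _
  exact continuous_const.mul ((continuous_apply k).comp continuous_subtype_val)

theorem translate_zero (z : space s t) : translate σ 0 z = z := by
  apply Subtype.ext; funext k; simp [translate]

theorem translate_add (a b : 𝓞 K) (z : space s t) :
    translate σ (a + b) z = translate σ a (translate σ b z) := by
  apply Subtype.ext; funext k; simp only [translate, map_add]; ring

theorem scale_one (z : space s t) : scale σ 1 z = z := by
  apply Subtype.ext; funext k; simp [scale]

theorem scale_mul (u v : totallyPositiveUnits K) (z : space s t) :
    scale σ (u * v) z = scale σ u (scale σ v z) := by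
  apply Subtype.ext; funext k
  simp only [scale, Subgroup.coe_mul, Units.val_mul, map_mul]; ring

theorem scale_translate (u : totallyPositiveUnits K) (a : 𝓞 K) (z : space s t) :
    scale σ u (translate σ a z) = translate σ (((u : (𝓞 K)ˣ) : 𝓞 K) * a) (scale σ u z) := by
  apply Subtype.ext; funext k
  simp only [scale, translate, map_mul]; ring

/-- The action of `𝓞 K` on `ℍ^s × ℂ^t` by translations. -/
def translateHom : Multiplicative (𝓞 K) →* (space s t ≃ₜ space s t) where
  toFun a :=
    { toFun := translate σ a.toAdd
      invFun := translate σ (-a.toAdd)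
      left_inv := fun z => by rw [← translate_add, neg_add_cancel, translate_zero]
      right_inv := fun z => by rw [← translate_add, add_neg_cancel, translate_zero]
      continuous_toFun := continuous_translate σ _
      continuous_invFun := continuous_translate σ _ }
  map_one' := by ext1 z; exact translate_zero σ z
  map_mul' a b := by ext1 z; exact translate_add σ a.toAdd b.toAdd z

/-- The action of the totally positive units on `ℍ^s × ℂ^t`. -/
def scaleHom : totallyPositiveUnits K →* (space s t ≃ₜ space s t) where
  toFun u :=
    { toFun := scale σ u
      invFun := scale σ u⁻¹
      left_inv := fun z => by rw [← scale_mul, inv_mul_cancel, scale_one]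
      right_inv := fun z => by rw [← scale_mul, mul_inv_cancel, scale_one]
      continuous_toFun := continuous_scale σ _
      continuous_invFun := continuous_scale σ _ }
  map_one' := by ext1 z; exact scale_one σ z
  map_mul' u v := by ext1 z; exact scale_mul σ u v z

/-- The action of a group `U` of totally positive units on the additive group `𝓞 K` by
multiplication. -/
def unitAut (U : Subgroup (totallyPositiveUnits K)) : U →* MulAut (Multiplicative (𝓞 K)) where
  toFun u := AddEquiv.toMultiplicative
    (DistribMulAction.toAddEquiv (𝓞 K) ((u : totallyPositiveUnits K) : (𝓞 K)ˣ))
  map_one' := by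
    ext1 a
    exact congrArg Multiplicative.ofAdd (one_smul (𝓞 K)ˣ a.toAdd)
  map_mul' u v := by
    ext1 a
    exact congrArg Multiplicative.ofAdd
      (mul_smul ((u : totallyPositiveUnits K) : (𝓞 K)ˣ) ((v : totallyPositiveUnits K) : (𝓞 K)ˣ)
        a.toAdd)

/-- The group `U ⋉ 𝓞 K`. -/
abbrev OTGroup (U : Subgroup (totallyPositiveUnits K)) : Type _ :=
  Multiplicative (𝓞 K) ⋊[unitAut U] U

variable (U : Subgroup (totallyPositiveUnits K))

/-- The action of `U ⋉ 𝓞 K` on `ℍ^s × ℂ^t`: `(a, u)` acts as `z ↦ (σ_k(u) z_k + σ_k(a))_k`. -/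
def action : OTGroup U →* (space s t ≃ₜ space s t) :=
  SemidirectProduct.lift (translateHom σ) ((scaleHom σ).comp U.subtype) (by
    intro u
    refine MonoidHom.ext fun a => ?_
    rw [MonoidHom.comp_apply, MonoidHom.comp_apply, MulEquiv.coe_toMonoidHom,
      MulEquiv.coe_toMonoidHom, MulAut.conj_apply, eq_mul_inv_iff_mul_eq]
    ext1 z
    exact (scale_translate σ (u : totallyPositiveUnits K) a.toAdd z).symm)

/-- The orbit relation of `U ⋉ 𝓞 K` on `ℍ^s × ℂ^t`. -/
def orbitSetoid : Setoid (space s t) where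
  r z w := ∃ g : OTGroup U, action σ U g z = w
  iseqv :=
    { refl := fun z => ⟨1, by rw [map_one]; rfl⟩
      symm := by
        rintro z w ⟨g, rfl⟩
        refine ⟨g⁻¹, ?_⟩
        rw [map_inv]
        exact (action σ U g).symm_apply_apply z
      trans := by
        rintro z w x ⟨g, rfl⟩ ⟨h, rfl⟩
        refine ⟨h * g, ?_⟩
        rw [map_mul]
        rfl }

/-- The Oeljeklaus-Toma manifold `X(K, U) = (ℍ^s × ℂ^t) / (U ⋉ 𝓞 K)`. -/
def Manifold : Type := Quotient (orbitSetoid σ U)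

instance : TopologicalSpace (Manifold σ U) :=
  inferInstanceAs (TopologicalSpace (Quotient (orbitSetoid σ U)))

/-- The universal covering `ℍ^s × ℂ^t → X(K, U)`. -/
def proj (z : space s t) : Manifold σ U := Quotient.mk (orbitSetoid σ U) z

/-- An element of `U ⋉ 𝓞 K`, viewed as a deck transformation of `ℍ^s × ℂ^t → X(K, U)`. -/
def deck (g : OTGroup U) : LCK.deckGroup (proj σ U) :=
  ⟨action σ U g, fun _ => Quotient.sound ((orbitSetoid σ U).symm ⟨g, rfl⟩)⟩

/-- The first `s` components of the logarithmic embedding, on `U`. -/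
def logEmbedding : Additive U →+ (Fin s → ℝ) where
  toFun u i :=
    Real.log ‖σ.emb (Sum.inl i) ((((u.toMul : totallyPositiveUnits K) : (𝓞 K)ˣ) : 𝓞 K) : K)‖
  map_zero' := by funext i; simp
  map_add' u v := by
    funext i
    simp only [toMul_add, Subgroup.coe_mul, Units.val_mul, map_mul, norm_mul, Pi.add_apply]
    refine Real.log_mul ?_ ?_ <;> simp

/-- `U` is admissible: it has rank `s`, and the projection of its logarithmic embedding onto the
first `s` factors is a full lattice in `ℝ^s`. -/
structure IsAdmissible : Prop where
  rank_eq : Module.finrank ℤ (Additive U) = s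
  discrete : DiscreteTopology (logEmbedding σ U).range
  span_eq_top : Submodule.span ℝ ((logEmbedding σ U).range : Set (Fin s → ℝ)) = ⊤

end

end OeljeklausToma

end

/-! Conjugating a translation by `u` multiplies its vector by `u`, so the automorphy factors of the
translations by `u * a` and `a` agree. For `u ≠ 1` the factor is therefore trivial on the ideal `(u
- 1)`, which has finite index, and being positive it is trivial on all of `𝓞 K`
(`translateFactor_eq_one`). The Kähler form is thus `𝓞 K`-periodic; since `𝓞 K` is a lattice in `ℝ^s
× ℂ^t`, the form and its first derivative are bounded wherever the imaginary parts in `ℍ^s` stay in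
a compact range (`exists_bound_on_strip`).

Fix a complex coordinate and average the coefficient of `dx ∧ dy` in it over discs of radius about
`R` in that coordinate plane. As the form is closed, moving the base point changes this mean only by
`O(1/R)` (`abs_planeMean_sub_le`, a Stokes argument). With `l` the eigenvalue of `u` on this
coordinate, homothety by `u` relates the mean at scale `R` to the mean at scale `‖l‖ * R` and
another base point, with ratio `χ(u) / ‖l‖ ^ 2` (`planeMean_scale`). The means lie between two
positive constants, so this ratio is `1` (`eq_one_of_approx_scaling`). -/

noncomputable section

namespace LCK

open MeasureTheory Topology Set

/-! ### Plane means of closed 2-forms -/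

section PlaneMean

variable {E : Type*} [NormedAddCommGroup E] [NormedSpace ℝ E]

/-- The mean of `f` over the affine real plane `p + L(ℂ)`, with weight `φ` at scale `R`. -/
def planeMean (φ : ℂ → ℝ) (L : ℂ →L[ℝ] E) (f : E → ℝ) (R : ℝ) (p : E) : ℝ :=
  ∫ w : ℂ, φ w * f (p + R • L w)

theorem fderiv_apply_of_closed {η : E → E [⋀^Fin 2]→L[ℝ] ℝ} {z : E}
    (hd : extDeriv η z = 0) (v a b : E) :
    fderiv ℝ η z v ![a, b] = fderiv ℝ η z a ![v, b] - fderiv ℝ η z b ![v, a] := by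
  have h : extDeriv η z ![v, a, b] = 0 := by rw [hd]; rfl
  rw [extDeriv, ContinuousAlternatingMap.alternatizeUncurryFin_apply, Fin.sum_univ_three] at h
  have h0 : (0 : Fin 3).removeNth ![v, a, b] = ![a, b] := by
    ext i; fin_cases i <;> rfl
  have h1 : (1 : Fin 3).removeNth ![v, a, b] = ![v, b] := by
    ext i; fin_cases i <;> rfl
  have h2 : (2 : Fin 3).removeNth ![v, a, b] = ![v, a] := by
    ext i; fin_cases i <;> rfl
  rw [h0, h1, h2] at h
  simp at h
  linarith

/-- Integration by parts moves the derivative onto the weight, so the bound does not involve the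
derivative of `g`. -/
theorem abs_integral_mul_fderiv_le {φ g : ℂ → ℝ} (hφ : ContDiff ℝ 1 φ)
    (hφc : HasCompactSupport φ) (hg : ContDiff ℝ 1 g) {M : ℝ} (hM : ∀ w, |g w| ≤ M) (v : ℂ) :
    |∫ w, φ w * fderiv ℝ g w v| ≤ (∫ w, |fderiv ℝ φ w v|) * M := by
  have hφ' : Continuous fun w => fderiv ℝ φ w v :=
    (hφ.continuous_fderiv one_ne_zero).clm_apply continuous_const
  have hg' : Continuous fun w => fderiv ℝ g w v :=
    (hg.continuous_fderiv one_ne_zero).clm_apply continuous_const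
  have hφ'c : HasCompactSupport fun w => fderiv ℝ φ w v := hφc.fderiv_apply ℝ v
  rw [integral_mul_fderiv_eq_neg_fderiv_mul_of_integrable
    ((hφ'.mul hg.continuous).integrable_of_hasCompactSupport hφ'c.mul_right)
    ((hφ.continuous.mul hg').integrable_of_hasCompactSupport hφc.mul_right)
    ((hφ.continuous.mul hg.continuous).integrable_of_hasCompactSupport hφc.mul_right)
    (fun x _ => (hφ.differentiable one_ne_zero) x) (fun x _ => (hg.differentiable one_ne_zero) x),
    abs_neg, ← integral_mul_const]
  refine (abs_integral_le_integral_abs).trans (integral_mono_of_nonneg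
    (Filter.Eventually.of_forall fun w => abs_nonneg _) ?_ (Filter.Eventually.of_forall fun w => ?_))
  · exact (hφ'.abs.integrable_of_hasCompactSupport (hφ'c.norm)).mul_const M
  · simp only [abs_mul]
    exact mul_le_mul_of_nonneg_left (hM w) (abs_nonneg _)

variable {S : Set E} {η : E → E [⋀^Fin 2]→L[ℝ] ℝ} {L : ℂ →L[ℝ] E}

/-- Differentiate the mean along the segment from `p` to `q`. Closedness trades the derivative
across the plane for derivatives along it; at scale `R` each of these costs a factor `1/R` and is
then integrated by parts against `φ`. The bound `B'` serves only to differentiate under the integral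
and does not enter the constant. -/
theorem abs_planeMean_sub_le (hS : IsOpen S) (hconv : Convex ℝ S) (hη : ContDiffOn ℝ 1 η S)
    (hd : ∀ z ∈ S, extDeriv η z = 0) (hL : ∀ z ∈ S, ∀ w, z + L w ∈ S)
    {B B' : ℝ} (hB : ∀ z ∈ S, ‖η z‖ ≤ B) (hB' : ∀ z ∈ S, ‖fderiv ℝ η z‖ ≤ B')
    {φ : ℂ → ℝ} (hφ : ContDiff ℝ 1 φ) (hφc : HasCompactSupport φ) {p q : E} (hp : p ∈ S)
    (hq : q ∈ S) :
    ∃ C, ∀ R > 0, |planeMean φ L (fun z => η z ![L 1, L Complex.I]) R q -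
      planeMean φ L (fun z => η z ![L 1, L Complex.I]) R p| ≤ C / R := by
  set v := q - p with hv
  have hdiff : ∀ z ∈ S, DifferentiableAt ℝ η z := fun z hz =>
    (hη.differentiableOn one_ne_zero).differentiableAt (hS.mem_nhds hz)
  have hB0 : 0 ≤ B := (norm_nonneg _).trans (hB p hp)
  have hbound : ∀ z ∈ S, ∀ a b : E, |η z ![a, b]| ≤ B * (‖a‖ * ‖b‖) := by
    intro z hz a b
    have := (η z).le_opNorm ![a, b]
    rw [Fin.prod_univ_two] at this
    exact this.trans (mul_le_mul_of_nonneg_right (hB z hz) (by positivity))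
  refine ⟨(∫ w, |fderiv ℝ φ w 1|) * (B * (‖v‖ * ‖L Complex.I‖)) +
    (∫ w, |fderiv ℝ φ w Complex.I|) * (B * (‖v‖ * ‖L 1‖)), fun R hR => ?_⟩
  have hmem : ∀ z ∈ S, ∀ w, z + R • L w ∈ S := fun z hz w => by
    have := hL z hz (R • w); rwa [map_smul] at this
  -- the planar function `w ↦ η_{z + R L w}(a, b)`
  have hcd : ∀ z ∈ S, ContDiff ℝ 1 fun w : ℂ => η (z + R • L w) := fun z hz => by
    refine contDiffOn_univ.1 (hη.comp (t := S) (s := univ) (f := fun w : ℂ => z + R • L w) ?_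
      fun w _ => hmem z hz w)
    exact (contDiff_const.add (contDiff_const.smul L.contDiff)).contDiffOn
  have hcd2 : ∀ z ∈ S, ∀ m, ContDiff ℝ 1 fun w : ℂ => η (z + R • L w) m := fun z hz m =>
    (ContinuousAlternatingMap.apply ℝ E ℝ m).contDiff.comp (hcd z hz)
  have hfd : ∀ z ∈ S, ∀ m w a, fderiv ℝ (fun w : ℂ => η (z + R • L w) m) w a =
      R * fderiv ℝ η (z + R • L w) (L a) m := by
    intro z hz m w a
    have h1 : HasFDerivAt (fun w : ℂ => z + R • L w) (R • L) w :=
      ((L.hasFDerivAt (x := w)).const_smul R).const_add z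
    have h2 := ((ContinuousAlternatingMap.apply ℝ E ℝ m).hasFDerivAt.comp w
      ((hdiff _ (hmem z hz w)).hasFDerivAt.comp w h1))
    rw [HasFDerivAt.fderiv (f := fun w : ℂ => η (z + R • L w) m) h2]
    simp
  have hline : ∀ τ ∈ Icc (0 : ℝ) 1, p + τ • v ∈ S := fun τ hτ =>
    hconv.add_smul_sub_mem hp hq hτ
  set F' : ℝ → ℂ → ℝ := fun τ w => φ w *
    fderiv ℝ η (p + τ • v + R • L w) v ![L 1, L Complex.I] with hF'
  have key : ∀ τ ∈ Icc (0 : ℝ) 1, HasDerivAt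
      (fun τ => planeMean φ L (fun z => η z ![L 1, L Complex.I]) R (p + τ • v))
      (∫ w, F' τ w) τ := by
    intro τ hτ
    have hcl : Continuous fun τ : ℝ => p + τ • v := by fun_prop
    refine (hasDerivAt_integral_of_dominated_loc_of_deriv_le
      (F := fun τ w => φ w * η (p + τ • v + R • L w) ![L 1, L Complex.I])
      (bound := fun w => |φ w| * (B' * ‖v‖ * (‖L 1‖ * ‖L Complex.I‖)))
      ((hS.preimage hcl).mem_nhds (hline τ hτ)) ?_ ?_ ?_ ?_ ?_ ?_).2
    · filter_upwards [(hS.preimage hcl).mem_nhds (hline τ hτ)] with x hx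
      exact (hφ.continuous.mul (hcd2 _ hx _).continuous).aestronglyMeasurable
    · exact (hφ.continuous.mul (hcd2 _ (hline τ hτ) _).continuous).integrable_of_hasCompactSupport
        hφc.mul_right
    · refine Continuous.aestronglyMeasurable (hφ.continuous.mul ?_)
      have h1 : Continuous fun w : ℂ => fderiv ℝ η (p + τ • v + R • L w) :=
        (hη.continuousOn_fderiv_of_isOpen hS le_rfl).comp_continuous (by fun_prop)
          (hmem _ (hline τ hτ))
      exact (ContinuousAlternatingMap.apply ℝ E ℝ _).continuous.comp (h1.clm_apply continuous_const)
    · refine Filter.Eventually.of_forall fun w x hx => ?_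
      rw [Real.norm_eq_abs, hF', abs_mul]
      refine mul_le_mul_of_nonneg_left ?_ (abs_nonneg _)
      have h1 := (fderiv ℝ η (p + x • v + R • L w) v).le_opNorm ![L 1, L Complex.I]
      rw [Fin.prod_univ_two] at h1
      refine h1.trans (mul_le_mul_of_nonneg_right ?_ (by positivity))
      exact ContinuousLinearMap.le_of_opNorm_le _ (hB' _ (hmem _ hx w)) v
    · exact (hφ.continuous.abs.integrable_of_hasCompactSupport hφc.norm).mul_const _
    · refine Filter.Eventually.of_forall fun w x hx => ?_
      have h1 : HasDerivAt (fun x : ℝ => p + x • v + R • L w) v x := by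
        simpa using (((hasDerivAt_id x).smul_const v).const_add p).add_const (R • L w)
      have h2 := (hdiff _ (hmem _ hx w)).hasFDerivAt.comp_hasDerivAt x h1
      have h3 := (ContinuousAlternatingMap.apply ℝ E ℝ
        ![L 1, L Complex.I]).hasFDerivAt.comp_hasDerivAt x h2
      exact h3.const_mul (φ w)
  have bound : ∀ τ ∈ Icc (0 : ℝ) 1, ‖∫ w, F' τ w‖ ≤
      ((∫ w, |fderiv ℝ φ w 1|) * (B * (‖v‖ * ‖L Complex.I‖)) +
        (∫ w, |fderiv ℝ φ w Complex.I|) * (B * (‖v‖ * ‖L 1‖))) / R := by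
    intro τ hτ
    have hz := hline τ hτ
    set z := p + τ • v
    -- Here `dη = 0` is used; `R⁻¹` undoes the chain rule of `w ↦ z + R • L w`.
    have hF : ∀ w, F' τ w = R⁻¹ *
        (φ w * fderiv ℝ (fun w : ℂ => η (z + R • L w) ![v, L Complex.I]) w 1 -
          φ w * fderiv ℝ (fun w : ℂ => η (z + R • L w) ![v, L 1]) w Complex.I) := by
      intro w
      rw [hfd z hz, hfd z hz, hF']
      simp only
      rw [fderiv_apply_of_closed (hd _ (hmem z hz w))]
      field_simp
    have hint : ∀ m a, Integrable fun w =>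
        φ w * fderiv ℝ (fun w : ℂ => η (z + R • L w) m) w a := fun m a =>
      (hφ.continuous.mul (((hcd2 z hz m).continuous_fderiv one_ne_zero).clm_apply
        continuous_const)).integrable_of_hasCompactSupport hφc.mul_right
    simp_rw [hF]
    rw [integral_const_mul, integral_sub (hint _ _) (hint _ _), Real.norm_eq_abs, abs_mul,
      abs_of_pos (inv_pos.2 hR), div_eq_inv_mul]
    refine mul_le_mul_of_nonneg_left ?_ (inv_pos.2 hR).le
    refine (abs_sub _ _).trans (add_le_add ?_ ?_)
    · exact abs_integral_mul_fderiv_le hφ hφc (hcd2 z hz _) (fun w => hbound _ (hmem z hz w) _ _) _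
    · exact abs_integral_mul_fderiv_le hφ hφc (hcd2 z hz _) (fun w => hbound _ (hmem z hz w) _ _) _
  have := norm_image_sub_le_of_norm_deriv_le_segment_01'
    (fun τ hτ => (key τ hτ).hasDerivWithinAt) (fun τ hτ => bound τ (Ico_subset_Icc_self hτ))
  simpa [hv] using this

end PlaneMean

end LCK

/-! ### Affine deck transformations -/

namespace LCK

open Topology

variable {ι X : Type*} [Fintype ι] {D : TopologicalSpace.Opens (ι → ℂ)} {p : D → X}

theorem LCKMetric.form_affine (g : LCKMetric D p) (γ : deckGroup p) {c b : ι → ℂ}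
    (hγ : ∀ z : D, ((γ : D ≃ₜ D) z : ι → ℂ) = c * z + b) {z : ι → ℂ} (hz : z ∈ D)
    (v w : ι → ℂ) :
    g.form (c * z + b) ![c * v, c * w] = g.factor γ * g.form z ![v, w] := by
  have hamb : ∀ x ∈ D, ambient (γ : D ≃ₜ D) x = c * x + b := fun x hx => by
    rw [ambient, dif_pos hx, hγ]
  have hderiv : HasFDerivAt (ambient (γ : D ≃ₜ D)) (ContinuousLinearMap.mul ℝ (ι → ℂ) c) z := by
    have h : HasFDerivAt (fun x : ι → ℂ => c * x + b) (ContinuousLinearMap.mul ℝ (ι → ℂ) c) z :=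
      ((ContinuousLinearMap.mul ℝ (ι → ℂ) c).hasFDerivAt).add_const b
    exact h.congr_of_eventuallyEq (Filter.eventuallyEq_of_mem (D.isOpen.mem_nhds hz) hamb)
  have h := congrArg (fun η => η ![v, w]) (g.homothety γ z hz)
  simp only [pullback, hderiv.fderiv, hamb z hz] at h
  rw [ContinuousAlternatingMap.compContinuousLinearMap_apply] at h
  have hvw : (⇑(ContinuousLinearMap.mul ℝ (ι → ℂ) c) ∘ ![v, w]) = ![c * v, c * w] := by
    ext i; fin_cases i <;> rfl
  rw [hvw] at h
  exact h

end LCK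

/-! ### Triviality of the automorphy factors of translations -/

namespace OeljeklausToma

open LCK

variable {K : Type*} [Field K] {s t : ℕ} (σ : Embeddings K s t)
  (U : Subgroup (totallyPositiveUnits K))

/-- The vector `(σ_k(x))_k` in `ℂ^{s+t}`. -/
def coords (x : K) : Fin s ⊕ Fin t → ℂ := fun k => σ.coord k x

theorem coords_add (a b : 𝓞 K) :
    coords σ ((a + b : 𝓞 K) : K) = coords σ (a : K) + coords σ (b : K) := by
  ext k; simp [coords]

theorem coords_mul (a b : 𝓞 K) :
    coords σ ((a * b : 𝓞 K) : K) = coords σ (a : K) * coords σ (b : K) := by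
  ext k; simp [coords]

/-- A unit in `U`, as an element of `K`. -/
abbrev unitVal (u : U) : K := (((u : totallyPositiveUnits K) : (𝓞 K)ˣ) : 𝓞 K)

theorem add_coords_mem {z : Fin s ⊕ Fin t → ℂ} (hz : z ∈ space s t) (a : 𝓞 K) :
    z + coords σ (a : K) ∈ space s t := (translate σ a ⟨z, hz⟩).2

theorem coords_mul_mem {z : Fin s ⊕ Fin t → ℂ} (hz : z ∈ space s t) (u : U) :
    coords σ (unitVal U u) * z ∈ space s t := (scale σ (u : totallyPositiveUnits K) ⟨z, hz⟩).2

variable {σ U} (g : LCKMetric (space s t) (proj σ U))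

theorem form_scale (u : U) {z : Fin s ⊕ Fin t → ℂ} (hz : z ∈ space s t)
    (v w : Fin s ⊕ Fin t → ℂ) :
    g.form (coords σ (unitVal U u) * z)
      ![coords σ (unitVal U u) * v, coords σ (unitVal U u) * w] =
      g.factor (deck σ U (SemidirectProduct.inr u)) * g.form z ![v, w] := by
  have h := g.form_affine (deck σ U (SemidirectProduct.inr u)) (c := coords σ (unitVal U u))
    (b := 0) (fun z => ?_) hz v w
  · rwa [add_zero] at h
  · change ((action σ U (SemidirectProduct.inr u)) z : Fin s ⊕ Fin t → ℂ) = _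
    rw [action, SemidirectProduct.lift_inr, add_zero]
    rfl

/-- The automorphy factor of the translation by `a`. -/
def translateFactor (a : 𝓞 K) : ℝ :=
  g.factor (deck σ U (SemidirectProduct.inl (Multiplicative.ofAdd a)))

theorem translateFactor_pos (a : 𝓞 K) : 0 < translateFactor g a := g.factor_pos _

theorem form_translate (a : 𝓞 K) {z : Fin s ⊕ Fin t → ℂ} (hz : z ∈ space s t)
    (v w : Fin s ⊕ Fin t → ℂ) :
    g.form (z + coords σ (a : K)) ![v, w] = translateFactor g a * g.form z ![v, w] := by
  have h := g.form_affine (deck σ U (SemidirectProduct.inl (Multiplicative.ofAdd a))) (c := 1)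
    (b := coords σ (a : K)) (fun z => ?_) hz v w
  · simpa only [one_mul, translateFactor] using h
  · change ((action σ U (SemidirectProduct.inl (Multiplicative.ofAdd a))) z :
      Fin s ⊕ Fin t → ℂ) = _
    rw [action, SemidirectProduct.lift_inl, one_mul]
    rfl

/-- The point `(i, …, i)` of `ℍ^s × ℂ^t`. -/
theorem const_I_mem_space : (fun _ => Complex.I : Fin s ⊕ Fin t → ℂ) ∈ space s t :=
  fun _ => by simp

/-- The index `k` only ensures positive dimension; in dimension zero the form vanishes and does not
determine the factors. -/
theorem exists_form_ne_zero (k : Fin s ⊕ Fin t) {z : Fin s ⊕ Fin t → ℂ} (hz : z ∈ space s t) :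
    ∃ v w, g.form z ![v, w] ≠ 0 :=
  ⟨Pi.single k 1, _, (g.isKahler.positive z hz (Pi.single k 1) (by simp)).ne'⟩

theorem translateFactor_add (k : Fin s ⊕ Fin t) (a b : 𝓞 K) :
    translateFactor g (a + b) = translateFactor g a * translateFactor g b := by
  obtain ⟨v, w, h⟩ := exists_form_ne_zero g k const_I_mem_space
  have h1 := form_translate g (a + b) const_I_mem_space v w
  rw [coords_add, add_comm (coords σ _), ← add_assoc,
    form_translate g a (add_coords_mem σ const_I_mem_space b),
    form_translate g b const_I_mem_space, ← mul_assoc] at h1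
  exact (mul_right_cancel₀ h h1).symm

theorem translateFactor_zero (k : Fin s ⊕ Fin t) : translateFactor g 0 = 1 := by
  have h := translateFactor_add g k 0 0
  rw [add_zero] at h
  exact (mul_eq_left₀ (translateFactor_pos g 0).ne').1 h.symm

theorem translateFactor_nsmul (k : Fin s ⊕ Fin t) (a : 𝓞 K) (n : ℕ) :
    translateFactor g (n • a) = translateFactor g a ^ n := by
  induction n with
  | zero => rw [zero_smul, pow_zero, translateFactor_zero g k]
  | succ n ih => rw [succ_nsmul, translateFactor_add g k, ih, pow_succ]

/-- Scaling after translating by `a` is translating by `u * a` after scaling; the factor of `u`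
cancels. -/
theorem translateFactor_unit_mul (k : Fin s ⊕ Fin t) (u : U) (a : 𝓞 K) :
    translateFactor g ((((u : totallyPositiveUnits K) : (𝓞 K)ˣ) : 𝓞 K) * a) =
      translateFactor g a := by
  obtain ⟨v, w, h⟩ := exists_form_ne_zero g k const_I_mem_space
  have h1 := form_scale g u (add_coords_mem σ const_I_mem_space a) v w
  rw [form_translate g a const_I_mem_space, mul_add, ← coords_mul,
    form_translate g _ (coords_mul_mem σ U const_I_mem_space u),
    form_scale g u const_I_mem_space, mul_left_comm] at h1
  exact mul_right_cancel₀ h (mul_left_cancel₀ (g.factor_pos _).ne' h1)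

theorem translateFactor_eq_one [NumberField K] (k : Fin s ⊕ Fin t) {u : U} (hu : u ≠ 1) (a : 𝓞 K) :
    translateFactor g a = 1 := by
  set x : 𝓞 K := (((u : totallyPositiveUnits K) : (𝓞 K)ˣ) : 𝓞 K) with hx
  have hx1 : x - 1 ≠ 0 := fun h => hu (Subtype.ext (Subtype.ext (Units.ext (sub_eq_zero.1 h))))
  have h1 : ∀ b, translateFactor g ((x - 1) * b) = 1 := fun b => by
    have h2 := translateFactor_add g k ((x - 1) * b) b
    rw [show (x - 1) * b + b = x * b by ring, translateFactor_unit_mul g k] at h2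
    exact (mul_eq_right₀ (translateFactor_pos g b).ne').1 h2.symm
  -- The norm `N` of the ideal `(x - 1)` lies in it, so `N • a` is a multiple of `x - 1` and the
  -- `N`-th power of the factor of `a` is `1`.
  obtain ⟨y, hy⟩ := Ideal.mem_span_singleton.1 (Ideal.absNorm_mem (Ideal.span {x - 1}))
  have h3 : Ideal.absNorm (Ideal.span {x - 1}) ≠ 0 := by
    rwa [Ne, Ideal.absNorm_eq_zero_iff, Ideal.span_singleton_eq_bot]
  have h4 := translateFactor_nsmul g k a (Ideal.absNorm (Ideal.span {x - 1}))
  rw [nsmul_eq_mul, hy, mul_assoc, h1] at h4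
  exact (pow_eq_one_iff_of_nonneg (translateFactor_pos g a).le h3).1 h4.symm

theorem form_add_coords [NumberField K] (k : Fin s ⊕ Fin t) {u : U} (hu : u ≠ 1) (a : 𝓞 K)
    {z : Fin s ⊕ Fin t → ℂ} (hz : z ∈ space s t) :
    g.form (z + coords σ (a : K)) = g.form z := by
  ext m
  have hm : m = ![m 0, m 1] := by ext i; fin_cases i <;> rfl
  rw [hm, form_translate g a hz, translateFactor_eq_one g k hu, one_mul]

theorem fderiv_form_add_coords [NumberField K] (k : Fin s ⊕ Fin t) {u : U} (hu : u ≠ 1) (a : 𝓞 K)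
    {z : Fin s ⊕ Fin t → ℂ} (hz : z ∈ space s t) :
    fderiv ℝ g.form (z + coords σ (a : K)) = fderiv ℝ g.form z := by
  rw [← fderiv_comp_add_right]
  exact Filter.EventuallyEq.fderiv_eq (Filter.eventuallyEq_of_mem
    ((space s t).isOpen.mem_nhds hz) fun x hx => form_add_coords g k hu a hx)

theorem exists_ne_one (hs : 0 < s) (hU : IsAdmissible σ U) : ∃ u : U, u ≠ 1 := by
  by_contra! h
  have : Subsingleton (Additive U) := ⟨fun a b => by
    have := (h a.toMul).trans (h b.toMul).symm
    exact this⟩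
  have := hU.rank_eq
  rw [Module.finrank_zero_of_subsingleton] at this
  omega

end OeljeklausToma

/-! ### The lattice of integers and bounds on strips -/

namespace OeljeklausToma

open scoped ComplexConjugate
open NumberField

variable {K : Type*} [Field K] [NumberField K] {s t : ℕ} (σ : Embeddings K s t)

/-- Conjugation-invariant vectors are real combinations of an integral basis; subtracting the
integer parts of the coefficients leaves fractional parts. -/
theorem exists_integer_near :
    ∃ B : ℝ, ∀ Z : (K →+* ℂ) → ℂ, (∀ φ, conj (Z φ) = Z (ComplexEmbedding.conjugate φ)) →
      ∃ a : 𝓞 K, ∀ φ, ‖Z φ + φ (a : K)‖ ≤ B := by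
  set b := canonicalEmbedding.latticeBasis K with hb
  have hbφ : ∀ i φ, b i φ = φ (integralBasis K i) := fun i φ => by
    rw [hb, canonicalEmbedding.latticeBasis_apply]; rfl
  refine ⟨∑ i, ‖b i‖, fun Z hZ => ?_⟩
  have hrep : ∀ φ, Z φ = ∑ i, ((b.repr Z i).re : ℂ) * φ (integralBasis K i) := by
    intro φ
    have h1 : ∀ φ, Z φ = ∑ i, b.repr Z i * φ (integralBasis K i) := fun φ => by
      conv_lhs => rw [← b.sum_repr Z]
      simp [Finset.sum_apply, hbφ]
    -- Conjugating the expansion at the conjugate embedding gives a second one; averaging the two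
    -- makes the coefficients real.
    have h2 : Z φ = ∑ i, conj (b.repr Z i) * φ (integralBasis K i) := by
      have h3 := congrArg conj (h1 (ComplexEmbedding.conjugate φ))
      rw [← hZ, Complex.conj_conj, map_sum] at h3
      simpa [ComplexEmbedding.conjugate_coe_eq] using h3
    have h4 : Z φ = (∑ i, b.repr Z i * φ (integralBasis K i) +
        ∑ i, conj (b.repr Z i) * φ (integralBasis K i)) / 2 := by
      rw [← h1, ← h2]; ring
    rw [h4, ← Finset.sum_add_distrib, Finset.sum_div]
    refine Finset.sum_congr rfl fun i _ => ?_
    rw [Complex.re_eq_add_conj]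
    ring
  refine ⟨-∑ i, ⌊(b.repr Z i).re⌋ • RingOfIntegers.basis K i, fun φ => ?_⟩
  have h1 : Z φ + φ ((-∑ i, ⌊(b.repr Z i).re⌋ • RingOfIntegers.basis K i : 𝓞 K) : K) =
      ∑ i, ((Int.fract (b.repr Z i).re : ℝ) : ℂ) * b i φ := by
    change _ + φ.comp (algebraMap (𝓞 K) K) _ = _
    rw [hrep, map_neg, map_sum, ← sub_eq_add_neg, ← Finset.sum_sub_distrib]
    refine Finset.sum_congr rfl fun i _ => ?_
    rw [map_zsmul, RingHom.comp_apply, hbφ, integralBasis_apply, zsmul_eq_mul, ← sub_mul, Int.fract]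
    push_cast
    rfl
  rw [h1]
  refine (norm_sum_le _ _).trans (Finset.sum_le_sum fun i _ => ?_)
  rw [norm_mul, Complex.norm_real, Real.norm_of_nonneg (Int.fract_nonneg _)]
  calc Int.fract (b.repr Z i).re * ‖b i φ‖ ≤ 1 * ‖b i‖ :=
        mul_le_mul (Int.fract_lt_one _).le (norm_le_pi_norm _ _) (norm_nonneg _) zero_le_one
    _ = ‖b i‖ := one_mul _

theorem exists_translate_near :
    ∃ B : ℝ, ∀ z : Fin s ⊕ Fin t → ℂ, ∃ a : 𝓞 K,
      (∀ i, |(z (Sum.inl i) + coords σ (a : K) (Sum.inl i)).re| ≤ B) ∧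
      ∀ j, ‖z (Sum.inr j) + coords σ (a : K) (Sum.inr j)‖ ≤ B := by
  obtain ⟨B, hB⟩ := exists_integer_near (K := K)
  refine ⟨B, fun z => ?_⟩
  set Y : Fin s ⊕ (Fin t ⊕ Fin t) → ℂ := Sum.elim (fun i => ((z (Sum.inl i)).re : ℂ))
    (Sum.elim (fun j => z (Sum.inr j)) (fun j => conj (z (Sum.inr j)))) with hY
  obtain ⟨a, ha⟩ := hB (fun φ => Y (σ.emb.symm φ)) (fun φ => by
    obtain ⟨k, rfl⟩ := σ.emb.surjective φ
    rcases k with i | j | j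
    · rw [show ComplexEmbedding.conjugate (σ.emb (Sum.inl i)) = σ.emb (Sum.inl i) from σ.isReal i]
      simp [hY]
    · rw [← σ.conj]
      simp [hY]
    · have h : ComplexEmbedding.conjugate (σ.emb (Sum.inr (Sum.inr j))) =
          σ.emb (Sum.inr (Sum.inl j)) := by
        rw [σ.conj, ComplexEmbedding.involutive_conjugate]
      rw [h]
      simp [hY])
  refine ⟨a, fun i => ?_, fun j => ?_⟩
  · have h := ha (σ.emb (Sum.inl i))
    rw [Equiv.symm_apply_apply] at h
    refine le_trans (le_of_eq ?_) ((Complex.abs_re_le_norm _).trans h)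
    simp [hY, coords, Embeddings.coord]
  · have h := ha (σ.emb (Sum.inr (Sum.inl j)))
    rw [Equiv.symm_apply_apply] at h
    exact h

/-- The points of `ℍ^s × ℂ^t` whose first `s` coordinates have imaginary parts in `(α, β)`. -/
def strip (s t : ℕ) (α β : ℝ) : Set (Fin s ⊕ Fin t → ℂ) :=
  {z | ∀ i : Fin s, (z (Sum.inl i)).im ∈ Set.Ioo α β}

theorem isOpen_strip (α β : ℝ) : IsOpen (strip s t α β) := by
  simp only [strip, Set.ofPred_forall]
  exact isOpen_iInter_of_finite fun i =>
    isOpen_Ioo.preimage (Complex.continuous_im.comp (continuous_apply _))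

theorem convex_strip (α β : ℝ) : Convex ℝ (strip s t α β) := by
  intro z hz w hw a b ha hb hab i
  simpa using convex_Ioo α β (hz i) (hw i) ha hb hab

theorem strip_subset {α β : ℝ} (hα : 0 ≤ α) : strip s t α β ⊆ space s t :=
  fun _ hz i => hα.trans_lt (hz i).1

theorem exists_mem_strip {z w : Fin s ⊕ Fin t → ℂ} (hz : z ∈ space s t) (hw : w ∈ space s t) :
    ∃ α β, 0 < α ∧ z ∈ strip s t α β ∧ w ∈ strip s t α β := by
  have key : ∀ z ∈ space s t, ∃ α β, 0 < α ∧ z ∈ strip s t α β := by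
    intro z hz
    obtain ⟨β, hβ⟩ := (Set.finite_range fun i : Fin s => (z (Sum.inl i)).im).bddAbove
    obtain ⟨γ, hγ⟩ := (Set.finite_range fun i : Fin s => (z (Sum.inl i)).im⁻¹).bddAbove
    refine ⟨(max γ 0 + 1)⁻¹, β + 1, by positivity, fun i => ⟨?_, ?_⟩⟩
    · refine inv_lt_of_inv_lt₀ (hz i) ?_
      exact (hγ ⟨i, rfl⟩).trans_lt ((le_max_left _ _).trans_lt (lt_add_one _))
    · exact (hβ ⟨i, rfl⟩).trans_lt (lt_add_one _)
  obtain ⟨α, β, hα, h⟩ := key z hz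
  obtain ⟨α', β', hα', h'⟩ := key w hw
  refine ⟨min α α', max β β', lt_min hα hα', fun i => ⟨?_, ?_⟩, fun i => ⟨?_, ?_⟩⟩
  · exact (min_le_left _ _).trans_lt (h i).1
  · exact (h i).2.trans_le (le_max_left _ _)
  · exact (min_le_right _ _).trans_lt (h' i).1
  · exact (h' i).2.trans_le (le_max_right _ _)

/-- A continuous function on `ℍ^s × ℂ^t` invariant under `𝓞 K` is bounded on strips. -/
theorem exists_bound_on_strip {F : (Fin s ⊕ Fin t → ℂ) → ℝ} (hF : ContinuousOn F (space s t))
    (hper : ∀ z ∈ space s t, ∀ a : 𝓞 K, F (z + coords σ (a : K)) = F z) {α : ℝ} (hα : 0 < α)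
    (β : ℝ) : ∃ B, ∀ z ∈ strip s t α β, F z ≤ B := by
  obtain ⟨B, hB⟩ := exists_translate_near σ
  -- Translations by integers preserve the imaginary parts of the first `s` coordinates, so they
  -- bring the whole strip into this box; `α > 0` keeps the box off the boundary.
  set Q : Set (Fin s ⊕ Fin t → ℂ) := Set.pi Set.univ
    (Sum.elim (fun _ => Set.Icc (-B) B ×ℂ Set.Icc α β) fun _ => Metric.closedBall 0 B) with hQ
  have hQc : IsCompact Q := isCompact_univ_pi fun k => by
    rcases k with i | j
    · exact isCompact_Icc.reProdIm isCompact_Icc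
    · exact isCompact_closedBall _ _
  have hQD : Q ⊆ space s t := fun z hz i => by
    have h := hz (Sum.inl i) trivial
    exact hα.trans_le (Complex.mem_reProdIm.1 h).2.1
  obtain ⟨C, hC⟩ := hQc.bddAbove_image (hF.mono hQD)
  refine ⟨C, fun z hz => ?_⟩
  obtain ⟨a, ha, ha'⟩ := hB z
  rw [← hper z (strip_subset hα.le hz) a]
  refine hC ⟨_, fun k _ => ?_, rfl⟩
  rcases k with i | j
  · refine Complex.mem_reProdIm.2 ⟨abs_le.1 (ha i), ?_⟩
    have h : (coords σ (a : K) (Sum.inl i)).im = 0 := by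
      rw [coords, coord_inl_eq_ofReal, Complex.ofReal_im]
    rw [Pi.add_apply, Complex.add_im, h, add_zero]
    exact Set.Ioo_subset_Icc_self (hz i)
  · simpa using ha' j

end OeljeklausToma

/-! ### Radial weight and approximate scaling -/

namespace LCK

open MeasureTheory

/-- A smooth radial function on `ℂ` with compact support. -/
def radialBump (w : ℂ) : ℝ := Real.smoothTransition (2 - ‖w‖ ^ 2)

theorem contDiff_radialBump : ContDiff ℝ 1 radialBump :=
  Real.smoothTransition.contDiff.comp (contDiff_const.sub (contDiff_norm_sq ℝ))

theorem hasCompactSupport_radialBump : HasCompactSupport radialBump := by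
  refine HasCompactSupport.intro (isCompact_closedBall 0 2) fun w hw => ?_
  rw [mem_closedBall_zero_iff, not_le] at hw
  exact Real.smoothTransition.zero_of_nonpos (by nlinarith)

theorem radialBump_nonneg (w : ℂ) : 0 ≤ radialBump w := Real.smoothTransition.nonneg _

theorem integrable_radialBump : Integrable radialBump :=
  contDiff_radialBump.continuous.integrable_of_hasCompactSupport hasCompactSupport_radialBump

theorem integral_radialBump_pos : 0 < ∫ w, radialBump w :=
  contDiff_radialBump.continuous.integral_pos_of_hasCompactSupport_nonneg_nonzero
    hasCompactSupport_radialBump radialBump_nonneg (x := 0)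
    (Real.smoothTransition.pos_of_pos (by simp)).ne'

theorem integral_radialBump_mul_rotate (h : ℂ → ℝ) (a : Circle) :
    ∫ w, radialBump w * h (a * w) = ∫ w, radialBump w * h w := by
  have h1 := (rotation a).measurePreserving.integral_comp
    (rotation a).toHomeomorph.measurableEmbedding (fun w => radialBump w * h w)
  rw [← h1]
  refine integral_congr_ae (Filter.Eventually.of_forall fun w => ?_)
  simp only [radialBump, rotation_apply, norm_mul, Circle.norm_coe, one_mul]

section

variable {E : Type*} [NormedAddCommGroup E] [NormedSpace ℝ E]

/-- Multiplication by `c` on `ℂ` has real determinant `‖c‖ ^ 2`. -/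
theorem map_mul_mul_I (η : E [⋀^Fin 2]→L[ℝ] ℝ) (L : ℂ →L[ℝ] E) (c : ℂ) :
    η ![L c, L (c * Complex.I)] = ‖c‖ ^ 2 * η ![L 1, L Complex.I] := by
  have hadd : ∀ a b d, η ![a + b, d] = η ![a, d] + η ![b, d] := fun a b d => η.vecCons_add ![d] a b
  have hsmul : ∀ (r : ℝ) a d, η ![r • a, d] = r * η ![a, d] := fun r a d => η.vecCons_smul ![d] r a
  have hswap : ∀ a b, η ![a, b] = - η ![b, a] := fun a b => by
    have h := η.map_swap ![b, a] (i := 0) (j := 1) (by decide)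
    refine Eq.trans (congrArg η ?_) h
    ext i; fin_cases i <;> rfl
  have hself : ∀ a, η ![a, a] = 0 := fun a => by linarith [hswap a a]
  have h1 : L c = c.re • L 1 + c.im • L Complex.I := by
    rw [← map_smul, ← map_smul, ← map_add]
    congr 1
    apply Complex.ext <;> simp
  have h2 : L (c * Complex.I) = (-c.im) • L 1 + c.re • L Complex.I := by
    rw [← map_smul, ← map_smul, ← map_add]
    congr 1
    apply Complex.ext <;> simp
  rw [h1, h2, hadd, hsmul, hsmul, hswap (L 1), hadd, hsmul, hsmul, hswap (L Complex.I) (_ + _), hadd,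
    hsmul, hsmul, hself, hself, hswap (L Complex.I) (L 1), Complex.sq_norm, Complex.normSq_apply]
  ring

end

/-- A function bounded away from `0` and `∞` with `A (r R) ≈ κ A R` as `R → ∞` has `1 ≤ κ`. -/
theorem one_le_of_approx_scaling {A : ℝ → ℝ} {κ r c M C : ℝ} (hκ : 0 < κ) (hr : 0 < r)
    (hc : 0 < c) (hlow : ∀ R, c ≤ A R) (hup : ∀ R, A R ≤ M)
    (h : ∀ R > 0, |κ * A R - A (r * R)| ≤ C / R) : 1 ≤ κ := by
  by_contra! hlt
  -- `sInf T` is the limsup of `A` at infinity. If `κ < 1`, the scaling relation would make it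
  -- smaller than itself.
  set T : Set ℝ := {x | ∀ᶠ R in Filter.atTop, A R ≤ x} with hT
  have hne : T.Nonempty := ⟨M, Filter.Eventually.of_forall hup⟩
  have hlb : ∀ x ∈ T, c ≤ x := fun x hx => by
    obtain ⟨R, hR⟩ := hx.exists
    exact (hlow R).trans hR
  have hpos : 0 < sInf T := hc.trans_le (le_csInf hne hlb)
  -- Chosen so that `κ * (sInf T + δ) + δ < sInf T`.
  set δ := sInf T * (1 - κ) / 4 with hδ
  have hδ0 : 0 < δ := by have := sub_pos.2 hlt; positivity
  obtain ⟨x, hx, hxlt⟩ := Real.lt_sInf_add_pos hne hδ0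
  have hmem : κ * x + δ ∈ T := by
    have h1 : Filter.Tendsto (fun R : ℝ => r⁻¹ * R) Filter.atTop Filter.atTop :=
      Filter.tendsto_id.const_mul_atTop (inv_pos.2 hr)
    have h2 : Filter.Tendsto (fun R : ℝ => C / (r⁻¹ * R)) Filter.atTop (nhds 0) :=
      h1.const_div_atTop C
    filter_upwards [h1.eventually hx, h1.eventually (Filter.eventually_gt_atTop 0),
      h2.eventually (gt_mem_nhds hδ0)] with R h3 h4 h5
    have h6 := h _ h4
    rw [mul_inv_cancel_left₀ hr.ne', abs_le] at h6
    have := mul_le_mul_of_nonneg_left h3 hκ.le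
    linarith [h6.1]
  have hle := csInf_le ⟨c, hlb⟩ hmem
  nlinarith [mul_lt_mul_of_pos_left hxlt hκ]

theorem eq_one_of_approx_scaling {A : ℝ → ℝ} {κ r c M C : ℝ} (hκ : 0 < κ) (hr : 0 < r)
    (hc : 0 < c) (hlow : ∀ R, c ≤ A R) (hup : ∀ R, A R ≤ M)
    (h : ∀ R > 0, |κ * A R - A (r * R)| ≤ C / R) : κ = 1 := by
  refine le_antisymm ?_ (one_le_of_approx_scaling hκ hr hc hlow hup h)
  -- The relation is symmetric: putting `r⁻¹ * R` for `R` and dividing by `κ` exchanges `(κ, r)`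
  -- with its inverses.
  refine (one_le_inv₀ hκ).1 (one_le_of_approx_scaling (C := κ⁻¹ * C * r) (inv_pos.2 hκ)
    (inv_pos.2 hr) hc hlow hup fun R hR => ?_)
  have h1 := mul_le_mul_of_nonneg_left (h (r⁻¹ * R) (by positivity)) (inv_pos.2 hκ).le
  rw [mul_inv_cancel_left₀ hr.ne', ← abs_of_pos (inv_pos.2 hκ), ← abs_mul,
    abs_of_pos (inv_pos.2 hκ), mul_sub, inv_mul_cancel_left₀ hκ.ne', abs_sub_comm] at h1
  refine h1.trans (le_of_eq ?_)
  field_simp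

end LCK

/-! ### Comparison of means under a unit -/

namespace OeljeklausToma

open LCK MeasureTheory

variable {K : Type*} [Field K] {s t : ℕ} {σ : Embeddings K s t}
  {U : Subgroup (totallyPositiveUnits K)} (g : LCKMetric (space s t) (proj σ U))

/-- The `k`-th complex coordinate axis in `ℂ^{s+t}`. -/
def axis (k : Fin s ⊕ Fin t) : ℂ →L[ℝ] (Fin s ⊕ Fin t → ℂ) :=
  (ContinuousLinearMap.single ℂ (fun _ => ℂ) k).restrictScalars ℝ

theorem axis_apply (k : Fin s ⊕ Fin t) (w : ℂ) : axis k w = Pi.single k w := rfl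

theorem mul_axis (k : Fin s ⊕ Fin t) (c : Fin s ⊕ Fin t → ℂ) (w : ℂ) :
    c * axis k w = axis k (c k * w) := by
  ext i
  rcases eq_or_ne i k with rfl | hi
  · simp [axis_apply]
  · simp [axis_apply, hi]

/-- The coefficient of `dx_k ∧ dy_k` in the Kähler form. -/
def coeff (k : Fin s ⊕ Fin t) (z : Fin s ⊕ Fin t → ℂ) : ℝ :=
  g.form z ![axis k 1, axis k Complex.I]

theorem coeff_pos (k : Fin s ⊕ Fin t) {z : Fin s ⊕ Fin t → ℂ} (hz : z ∈ space s t) :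
    0 < coeff g k z := by
  have h := g.isKahler.positive z hz (axis k 1) (by simp [axis_apply])
  rwa [show Complex.I • axis k 1 = axis k Complex.I by
    rw [axis_apply, axis_apply, ← Pi.single_smul, smul_eq_mul, mul_one]] at h

theorem coeff_scale (k : Fin s ⊕ Fin t) (u : U) {z : Fin s ⊕ Fin t → ℂ} (hz : z ∈ space s t) :
    ‖σ.coord k (unitVal U u)‖ ^ 2 * coeff g k (coords σ (unitVal U u) * z) =
      g.factor (deck σ U (SemidirectProduct.inr u)) * coeff g k z := by
  rw [coeff, coeff, ← form_scale g u hz, mul_axis, mul_axis, mul_one]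
  exact (map_mul_mul_I _ _ _).symm

theorem continuousOn_form : ContinuousOn g.form (space s t) := g.isKahler.smooth.continuousOn

theorem continuousOn_coeff (k : Fin s ⊕ Fin t) : ContinuousOn (coeff g k) (space s t) :=
  (ContinuousAlternatingMap.apply ℝ _ ℝ _).continuous.comp_continuousOn (continuousOn_form g)

theorem add_axis_mem_strip {α β : ℝ} {z : Fin s ⊕ Fin t → ℂ} (hz : z ∈ strip s t α β) (j : Fin t)
    (w : ℂ) : z + axis (Sum.inr j) w ∈ strip s t α β := fun i => by
  simpa [axis_apply] using hz i

theorem add_smul_axis_mem_strip {α β : ℝ} {z : Fin s ⊕ Fin t → ℂ} (hz : z ∈ strip s t α β)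
    (j : Fin t) (R : ℝ) (w : ℂ) : z + R • axis (Sum.inr j) w ∈ strip s t α β := by
  rw [← map_smul]
  exact add_axis_mem_strip hz j _

/-- The modulus of the eigenvalue rescales `R`; its argument rotates the plane and is absorbed by
the radial weight. -/
theorem planeMean_scale (j : Fin t) (u : U) {α β : ℝ} (hα : 0 < α) {z : Fin s ⊕ Fin t → ℂ}
    (hz : z ∈ strip s t α β) (R : ℝ) :
    ‖σ.coord (Sum.inr j) (unitVal U u)‖ ^ 2 *
      planeMean radialBump (axis (Sum.inr j)) (coeff g (Sum.inr j))
        (‖σ.coord (Sum.inr j) (unitVal U u)‖ * R) (coords σ (unitVal U u) * z) =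
      g.factor (deck σ U (SemidirectProduct.inr u)) *
        planeMean radialBump (axis (Sum.inr j)) (coeff g (Sum.inr j)) R z := by
  set l := σ.coord (Sum.inr j) (unitVal U u) with hl
  have hl0 : ‖l‖ ≠ 0 := by
    rw [norm_ne_zero_iff, hl, map_ne_zero]
    simp [unitVal]
  have haw : ∃ a : Circle, (‖l‖ : ℂ) * a = l := by
    refine ⟨⟨l / ‖l‖, ?_⟩, ?_⟩
    · simp [Submonoid.unitSphere, hl0]
    · have : (‖l‖ : ℂ) ≠ 0 := by exact_mod_cast hl0
      field_simp
  obtain ⟨a, ha⟩ := haw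
  rw [planeMean, planeMean, ← integral_radialBump_mul_rotate _ a, ← integral_const_mul,
    ← integral_const_mul]
  refine integral_congr_ae (Filter.Eventually.of_forall fun w => ?_)
  have h1 := coeff_scale g (Sum.inr j) u
    (strip_subset hα.le (add_smul_axis_mem_strip hz j R w))
  have h2 : (‖l‖ * R) • axis (Sum.inr j) (a * w) =
      coords σ (unitVal U u) * (R • axis (s := s) (Sum.inr j) w) := by
    rw [mul_smul_comm, mul_axis, mul_comm, mul_smul, ← map_smul]
    congr 2
    change _ = l * w
    rw [Complex.real_smul, ← mul_assoc, ha]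
  simp only
  rw [h2, ← mul_add, mul_left_comm, h1, mul_left_comm]

theorem factor_eq [NumberField K] (hs : 0 < s) (hU : IsAdmissible σ U) (u : U) (j : Fin t) :
    g.factor (deck σ U (SemidirectProduct.inr u)) =
      ‖σ.coord (Sum.inr j) (unitVal U u)‖ ^ 2 := by
  obtain ⟨u₀, hu₀⟩ := exists_ne_one hs hU
  set k : Fin s ⊕ Fin t := Sum.inr j
  set l := σ.coord k (unitVal U u) with hl
  have hl0 : 0 < ‖l‖ := by
    rw [norm_pos_iff, hl, map_ne_zero]
    simp [unitVal]
  set p : Fin s ⊕ Fin t → ℂ := fun _ => Complex.I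
  have hp : p ∈ space s t := const_I_mem_space
  set q := coords σ (unitVal U u) * p
  -- A convex strip containing `p` and its image `q` under `u`, on which periodicity gives uniform
  -- bounds.
  obtain ⟨α, β, hα, hpS, hqS⟩ := exists_mem_strip hp (coords_mul_mem σ U hp u)
  have hSD := strip_subset (s := s) (t := t) (β := β) hα.le
  have hper : ∀ z ∈ space s t, ∀ a : 𝓞 K, g.form (z + coords σ (a : K)) = g.form z :=
    fun z hz a => form_add_coords g k hu₀ a hz
  obtain ⟨B, hB⟩ := exists_bound_on_strip σ (continuousOn_form g).norm
    (fun z hz a => by rw [hper z hz]) hα β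
  obtain ⟨B', hB'⟩ := exists_bound_on_strip σ (F := fun z => ‖fderiv ℝ g.form z‖)
    (g.isKahler.smooth.continuousOn_fderiv_of_isOpen (space s t).isOpen (by simp)).norm
    (fun z hz a => by rw [fderiv_form_add_coords g k hu₀ a hz]) hα β
  obtain ⟨M, hM⟩ := exists_bound_on_strip σ (continuousOn_coeff g k)
    (fun z hz a => by rw [coeff, coeff, hper z hz]) hα β
  -- Bounding the inverse keeps the coefficient, hence its means, away from `0`.
  obtain ⟨N, hN⟩ := exists_bound_on_strip σ (F := fun z => (coeff g k z)⁻¹)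
    ((continuousOn_coeff g k).inv₀ fun z hz => (coeff_pos g k hz).ne')
    (fun z hz a => by rw [coeff, coeff, hper z hz]) hα β
  have hN0 : 0 < N := (inv_pos.2 (coeff_pos g k hp)).trans_le (hN p hpS)
  have hlow : ∀ z ∈ strip s t α β, N⁻¹ ≤ coeff g k z := fun z hz =>
    inv_le_of_inv_le₀ (coeff_pos g k (hSD hz)) (hN z hz)
  obtain ⟨C, hC⟩ := abs_planeMean_sub_le (isOpen_strip α β) (convex_strip α β)
    ((g.isKahler.smooth.mono hSD).of_le (by simp)) (fun z hz => g.isKahler.closed z (hSD hz))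
    (L := axis k) (fun z hz w => add_axis_mem_strip hz j w) hB hB' contDiff_radialBump
    hasCompactSupport_radialBump hpS hqS
  change ∀ R > 0, |planeMean radialBump (axis k) (coeff g k) R q -
    planeMean radialBump (axis k) (coeff g k) R p| ≤ C / R at hC
  set A : ℝ → ℝ := fun R => planeMean radialBump (axis k) (coeff g k) R p with hA
  have hcont : ∀ R : ℝ, Continuous fun w => coeff g k (p + R • axis k w) := fun R =>
    (continuousOn_coeff g k).comp_continuous (by fun_prop)
      fun w => hSD (add_smul_axis_mem_strip hpS j R w)
  have hint : ∀ R : ℝ, Integrable fun w => radialBump w * coeff g k (p + R • axis k w) := fun R =>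
    (contDiff_radialBump.continuous.mul (hcont R)).integrable_of_hasCompactSupport
      hasCompactSupport_radialBump.mul_right
  have hAlow : ∀ R, (∫ w, radialBump w) * N⁻¹ ≤ A R := fun R => by
    rw [← integral_mul_const]
    exact integral_mono (integrable_radialBump.mul_const _) (hint R) fun w =>
      mul_le_mul_of_nonneg_left (hlow _ (add_smul_axis_mem_strip hpS j R w)) (radialBump_nonneg w)
  have hAup : ∀ R, A R ≤ (∫ w, radialBump w) * M := fun R => by
    rw [← integral_mul_const]
    exact integral_mono (hint R) (integrable_radialBump.mul_const _) fun w =>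
      mul_le_mul_of_nonneg_left (hM _ (add_smul_axis_mem_strip hpS j R w)) (radialBump_nonneg w)
  set χ := g.factor (deck σ U (SemidirectProduct.inr u)) with hχ
  have hχ0 : 0 < χ := g.factor_pos _
  have hone : χ / ‖l‖ ^ 2 = 1 := by
    refine eq_one_of_approx_scaling (C := C / ‖l‖) (div_pos hχ0 (by positivity)) hl0
      (mul_pos integral_radialBump_pos (inv_pos.2 hN0)) hAlow hAup fun R hR => ?_
    have h1 := planeMean_scale g j u hα hpS R
    have h2 : χ / ‖l‖ ^ 2 * A R =
        planeMean radialBump (axis k) (coeff g k) (‖l‖ * R) q := by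
      rw [div_mul_eq_mul_div, div_eq_iff (by positivity), mul_comm _ (‖l‖ ^ 2)]
      exact h1.symm
    rw [h2, div_div]
    exact hC _ (mul_pos hl0 hR)
  exact (div_eq_one_iff_eq (by positivity)).1 hone

end OeljeklausToma

end

theorem mainTheorem2 {K : Type*} [Field K] [NumberField K] {s t : ℕ} (hs : 0 < s) (ht : 0 < t)
    (σ : OeljeklausToma.Embeddings K s t)
    (U : Subgroup (OeljeklausToma.totallyPositiveUnits K))
    (hU : OeljeklausToma.IsAdmissible σ U)
    (g : LCK.LCKMetric (OeljeklausToma.space s t) (OeljeklausToma.proj σ U)) :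
    (∀ (u : U) (j : Fin t),
      g.factor (OeljeklausToma.deck σ U (SemidirectProduct.inr u)) =
        ‖σ.emb (Sum.inr (Sum.inl j))
          ((((u : OeljeklausToma.totallyPositiveUnits K) : (𝓞 K)ˣ) : 𝓞 K) : K)‖ ^ 2)
    ∧ ∀ (u : U) (j k : Fin t),
      ‖σ.emb (Sum.inr (Sum.inl j))
          ((((u : OeljeklausToma.totallyPositiveUnits K) : (𝓞 K)ˣ) : 𝓞 K) : K)‖ =
        ‖σ.emb (Sum.inr (Sum.inl k))
          ((((u : OeljeklausToma.totallyPositiveUnits K) : (𝓞 K)ˣ) : 𝓞 K) : K)‖ := by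
  have h := OeljeklausToma.factor_eq g hs hU
  exact ⟨h, fun u j k => (pow_left_inj₀ (norm_nonneg _) (norm_nonneg _) two_ne_zero).1
    ((h u j).symm.trans (h u k))⟩
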